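/- Let $n\ge 1$ and $k_1,\dots,k_n\ge 1$ be integers, let $M_k$ denote the space of complex $k\times k$ matrices, and identify $M_{k_1}\otimes\cdots\otimes M_{k_n}$ with $M_{k_1\cdots k_n}$ via the Kronecker product. The tensor rank of $A\in M_{k_1}\otimes\cdots\otimes M_{k_n}$ is the minimal number $r$ of nonzero elementary tensors $A_1\otimes\cdots\otimes A_n$ (with $A_i\in M_{k_i}$) whose sum is $A$ (so $0$ has tensor rank $0$). If $A\in M_{k_1}\otimes\cdots\otimes M_{k_n}$ is a positive semidefinite Hermitian matrix of tensor rank at most $2$, then $A$ is separable, that is, there are finitely many families $(C^{(j)}_1,\dots,C^{(j)}_n)$, $1\le j\le m$, of positive semidefinite Hermitian matrices $C^{(j)}_i\in M_{k_i}$ such that $$A=\sum_{j=1}^m C^{(j)}_1\otimes\cdots\otimes C^{(j)}_n .$$ -/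

import Mathlib

open scoped TensorProduct ComplexOrder

/-- The tensor rank of `t ∈ V₁ ⊗ ⋯ ⊗ Vₙ`: the least number of tensors of rank one, that is, nonzero
elementary tensors `v₁ ⊗ ⋯ ⊗ vₙ`, whose sum is `t` (so the zero tensor has rank `0`; the value
would be `⊤` if no such sum existed). -/
noncomputable def tensorRank {K : Type*} [Field K] {n : ℕ} {V : Fin n → Type*}
    [∀ i, AddCommGroup (V i)] [∀ i, Module K (V i)] (t : ⨂[K] i, V i) : ℕ∞ :=
  sInf {m : ℕ∞ | ∃ (r : ℕ) (v : Fin r → ∀ i, V i), m = r ∧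
    (∀ j, PiTensorProduct.tprod K (v j) ≠ 0) ∧ t = ∑ j, PiTensorProduct.tprod K (v j)}

/-- The tensor product `M_{k₁} ⊗ ⋯ ⊗ M_{kₙ}` of complex matrix spaces. -/
abbrev MatrixTensor {n : ℕ} (k : Fin n → ℕ) : Type :=
  ⨂[ℂ] i, Matrix (Fin (k i)) (Fin (k i)) ℂ

/-- The Kronecker product of `A₁, …, Aₙ`, with rows and columns indexed by multi-indices:
its entry at `(x, y)` is `∏ i, Aᵢ (xᵢ, yᵢ)`. -/
def multiKronecker {n : ℕ} (k : Fin n → ℕ) : MultilinearMap ℂ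
    (fun i => Matrix (Fin (k i)) (Fin (k i)) ℂ)
    (Matrix (∀ i, Fin (k i)) (∀ i, Fin (k i)) ℂ) where
  toFun A := Matrix.of fun x y => ∏ i, A i (x i) (y i)
  map_update_add' A i B C := by
    ext x y
    have h : ∀ D : Matrix (Fin (k i)) (Fin (k i)) ℂ,
        ∏ j, Function.update A i D j (x j) (y j)
          = D (x i) (y i) * ∏ j ∈ Finset.univ.erase i, A j (x j) (y j) := by
      intro D
      rw [← Finset.mul_prod_erase _ _ (Finset.mem_univ i), Function.update_self]
      congr 1
      refine Finset.prod_congr rfl fun j hj => ?_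
      rw [Function.update_of_ne (Finset.ne_of_mem_erase hj)]
    simp only [Matrix.of_apply, Matrix.add_apply, h, add_mul]
  map_update_smul' A i c B := by
    ext x y
    have h : ∀ D : Matrix (Fin (k i)) (Fin (k i)) ℂ,
        ∏ j, Function.update A i D j (x j) (y j)
          = D (x i) (y i) * ∏ j ∈ Finset.univ.erase i, A j (x j) (y j) := by
      intro D
      rw [← Finset.mul_prod_erase _ _ (Finset.mem_univ i), Function.update_self]
      congr 1
      refine Finset.prod_congr rfl fun j hj => ?_
      rw [Function.update_of_ne (Finset.ne_of_mem_erase hj)]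
    simp only [Matrix.of_apply, Matrix.smul_apply, h, smul_eq_mul, mul_assoc]

/-- The identification of `M_{k₁} ⊗ ⋯ ⊗ M_{kₙ}` with the square matrices of order `k₁ ⋯ kₙ` via the
Kronecker product: the linear map with `A₁ ⊗ ⋯ ⊗ Aₙ ↦` Kronecker product of the `Aᵢ`. -/
noncomputable def MatrixTensor.toMatrix {n : ℕ} (k : Fin n → ℕ) : MatrixTensor k →ₗ[ℂ]
    Matrix (∀ i, Fin (k i)) (∀ i, Fin (k i)) ℂ :=
  PiTensorProduct.lift (multiKronecker k)

/-- The identification via the Kronecker product is a bijection. -/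
theorem MatrixTensor.toMatrix_bijective {n : ℕ} (k : Fin n → ℕ) :
    Function.Bijective (MatrixTensor.toMatrix k) := by
  classical
  let b := Basis.piTensorProduct (fun i => Matrix.stdBasis ℂ (Fin (k i)) (Fin (k i)))
  let e : (∀ i, Fin (k i) × Fin (k i)) ≃ (∀ i, Fin (k i)) × (∀ i, Fin (k i)) :=
    Equiv.arrowProdEquivProdArrow _ _ _
  let f := b.equiv (Matrix.stdBasis ℂ (∀ i, Fin (k i)) (∀ i, Fin (k i))) e
  have h : MatrixTensor.toMatrix k = f.toLinearMap := by
    refine b.ext fun p => ?_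
    rw [LinearEquiv.coe_coe, Module.Basis.equiv_apply, Basis.piTensorProduct_apply,
      MatrixTensor.toMatrix, PiTensorProduct.lift.tprod]
    ext x y
    have he : e p = (fun i => (p i).1, fun i => (p i).2) := rfl
    rw [he, Matrix.stdBasis_eq_single]
    simp only [multiKronecker, MultilinearMap.coe_mk, Matrix.of_apply]
    have hi : ∀ i, (Matrix.stdBasis ℂ (Fin (k i)) (Fin (k i))) (p i)
        = Matrix.single (p i).1 (p i).2 1 := fun i => Matrix.stdBasis_eq_single ℂ (p i).1 (p i).2
    simp only [hi, Matrix.single_apply, Finset.prod_ite_zero, Finset.prod_const_one]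
    congr 1
    simp [funext_iff, forall_and]
  rw [h]
  exact f.bijective

/-- `A ∈ M_{k₁} ⊗ ⋯ ⊗ M_{kₙ}` is a positive semidefinite Hermitian matrix. -/
def MatrixTensor.IsPosSemidef {n : ℕ} {k : Fin n → ℕ} (A : MatrixTensor k) : Prop :=
  (MatrixTensor.toMatrix k A).PosSemidef

/-- `A ∈ M_{k₁} ⊗ ⋯ ⊗ M_{kₙ}` is separable: it is a finite sum of tensors `C₁ ⊗ ⋯ ⊗ Cₙ` with every
`Cᵢ ∈ M_{kᵢ}` positive semidefinite Hermitian. -/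
def MatrixTensor.IsSeparable {n : ℕ} {k : Fin n → ℕ} (A : MatrixTensor k) : Prop :=
  ∃ (r : ℕ) (C : Fin r → ∀ i, Matrix (Fin (k i)) (Fin (k i)) ℂ),
    (∀ j i, (C j i).PosSemidef) ∧ A = ∑ j, PiTensorProduct.tprod ℂ (C j)

/-! Contract `A` in all factors but the `i`-th with quadratic forms. Since `A` is positive
semidefinite, the results are positive semidefinite; since the rank is at most 2, they span a space
of dimension at most 2, hence lie in the span of two positive semidefinite matrices. These are
simultaneously diagonal under a congruence, which gives a map `pᵢ : X ↦ ∑ a, (uₐ* X uₐ) Eₐ`, with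
`Eₐ` positive semidefinite, fixing every contraction (`exists_quadForm_posSemidef_expansion`).
Product forms separate tensors, so `p₁ ⊗ ⋯ ⊗ pₙ` fixes `A` (`map_eq_self`). Expanding writes `A` as
a combination of tensors of the `Eₐ`, whose coefficients are values of the form of `A` at product
vectors, hence nonnegative. -/

namespace Matrix

/-! ### Quadratic forms and simultaneous diagonalization by congruence. -/

variable {ι : Type*} [Fintype ι]

/-- The quadratic form `X ↦ w* X w` as a linear functional of the matrix `X`. -/
noncomputable def quadForm (w : ι → ℂ) : Module.Dual ℂ (Matrix ι ι ℂ) where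
  toFun X := star w ⬝ᵥ X *ᵥ w
  map_add' X Y := by rw [add_mulVec, dotProduct_add]
  map_smul' c X := by rw [smul_mulVec, dotProduct_smul, RingHom.id_apply]

theorem quadForm_apply (w : ι → ℂ) (X : Matrix ι ι ℂ) : quadForm w X = star w ⬝ᵥ X *ᵥ w := rfl

/-- Polarization: the entries of a matrix are linear combinations of values of its quadratic
form. -/
theorem entryLinearMap_mem_span_quadForm (x y : ι) :
    entryLinearMap ℂ ℂ x y ∈ Submodule.span ℂ (Set.range (quadForm (ι := ι))) := by
  classical
  have h : entryLinearMap ℂ ℂ x y = (4⁻¹ : ℂ) •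
      (quadForm (Pi.single x 1 + Pi.single y 1) - quadForm (Pi.single x 1 - Pi.single y 1)
        - Complex.I • quadForm (Pi.single x 1 + Complex.I • Pi.single y 1)
        + Complex.I • quadForm (Pi.single x 1 - Complex.I • Pi.single y 1)) := by
    ext1 X
    simp only [entryLinearMap_apply, LinearMap.smul_apply, LinearMap.add_apply,
      LinearMap.sub_apply, quadForm_apply, star_add, star_sub, star_smul, Pi.star_single, star_one,
      mulVec_add, mulVec_sub, mulVec_smul, dotProduct_add, dotProduct_sub, dotProduct_smul,
      add_dotProduct, sub_dotProduct, smul_dotProduct, mulVec_single_one, single_one_dotProduct,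
      smul_eq_mul, Complex.star_def, Complex.conj_I, col_apply]
    linear_combination ((1 / 2 : ℂ) * X x y - 1 / 2 * X y x) * Complex.I_mul_I
  have hq (w : ι → ℂ) : quadForm w ∈ Submodule.span ℂ (Set.range (quadForm (ι := ι))) :=
    Submodule.subset_span ⟨w, rfl⟩
  rw [h]
  exact Submodule.smul_mem _ _ (add_mem (sub_mem (sub_mem (hq _) (hq _))
    (Submodule.smul_mem _ _ (hq _))) (Submodule.smul_mem _ _ (hq _)))

/-- Over `ℂ`, `0 ≤ z` includes that `z` is real, so hermiticity need not be assumed. -/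
theorem posSemidef_of_quadForm_nonneg {X : Matrix ι ι ℂ} (h : ∀ w, 0 ≤ quadForm w X) :
    X.PosSemidef := by
  classical
  rw [← isPositive_toEuclideanLin_iff, LinearMap.isPositive_iff_complex]
  intro w
  have hw := h w.ofLp
  have e : inner ℂ (toEuclideanLin X w) w = star (quadForm w.ofLp X) := by
    rw [← inner_conj_symm, EuclideanSpace.inner_eq_star_dotProduct, dotProduct_comm]
    rfl
  obtain ⟨h1, h2⟩ := Complex.nonneg_iff.1 hw
  rw [e]
  refine ⟨?_, by simpa using h1⟩
  apply Complex.ext <;> simp [← h2]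

/-- A positive semidefinite matrix is `L * Lᴴ` with `L` left invertible. -/
theorem PosSemidef.exists_leftInverse_factor [DecidableEq ι] {S : Matrix ι ι ℂ}
    (hS : S.PosSemidef) : ∃ (s : Finset ι) (L : Matrix ι s ℂ) (M : Matrix s ι ℂ),
      M * L = 1 ∧ S = L * Lᴴ := by
  let d := hS.1.eigenvalues
  let U : Matrix ι ι ℂ := hS.1.eigenvectorUnitary
  have hU : Uᴴ * U = 1 := Unitary.coe_star_mul_self hS.1.eigenvectorUnitary
  have hd (i) : 0 ≤ d i := hS.eigenvalues_nonneg i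
  have hSd : S = U * diagonal (fun i => (d i : ℂ)) * Uᴴ := by
    have := hS.1.spectral_theorem
    rwa [Unitary.conjStarAlgAut_apply] at this
  let s := Finset.univ.filter fun i => d i ≠ 0
  -- Eigenvectors of nonzero eigenvalue scaled by `√d`; the left inverse scales their adjoints by
  -- `1/√d`.
  refine ⟨s, of fun i a => U i a * (√(d a) : ℂ), of fun a i => (√(d a) : ℂ)⁻¹ * Uᴴ a i, ?_, ?_⟩
  · ext a b
    have hab : ∑ i, Uᴴ a i * U i b = (1 : Matrix ι ι ℂ) a b := by rw [← hU, mul_apply]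
    have ha : (√(d a) : ℂ) ≠ 0 := by
      have := (Finset.mem_filter.1 a.2).2
      exact Complex.ofReal_ne_zero.2 (Real.sqrt_ne_zero'.2 (lt_of_le_of_ne (hd a) this.symm))
    have : ∑ i, (√(d a) : ℂ)⁻¹ * Uᴴ a i * (U i b * (√(d b) : ℂ))
        = (√(d a) : ℂ)⁻¹ * (√(d b) : ℂ) * (1 : Matrix ι ι ℂ) a b := by
      rw [← hab, Finset.mul_sum]
      exact Finset.sum_congr rfl fun i _ => by ring
    rw [mul_apply]
    simp only [of_apply]
    rw [this]
    by_cases h : a = b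
    · subst h; simp [ha]
    · rw [one_apply_ne h, one_apply_ne (fun h' => h (Subtype.ext h')), mul_zero]
  · ext x y
    rw [hSd, mul_apply, mul_apply]
    simp only [mul_diagonal, conjTranspose_apply, of_apply]
    rw [← Finset.sum_subset (Finset.subset_univ s), ← Finset.sum_coe_sort s]
    · refine Finset.sum_congr rfl fun a _ => ?_
      have : (d a : ℂ) = √(d a) * √(d a) := by
        rw [← Complex.ofReal_mul, Real.mul_self_sqrt (hd a)]
      rw [this]
      simp only [star_mul', Complex.star_def, Complex.conj_ofReal]
      ring
    · intro a _ ha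
      have : d a = 0 := by simpa [s] using ha
      simp [this]

theorem PosSemidef.mul_eq_zero_of_conjTranspose_mul_mul {κ : Type*} {P : Matrix ι ι ℂ}
    (hP : P.PosSemidef) {K : Matrix ι κ ℂ} (h : Kᴴ * P * K = 0) : P * K = 0 := by
  ext x a
  have h1 : star (K.col a) ⬝ᵥ P *ᵥ K.col a = 0 := by
    have := congr_fun (congr_fun h a) a
    rw [Matrix.mul_assoc, mul_apply] at this
    simpa [dotProduct, mulVec, mul_apply] using this
  have h2 := congr_fun ((hP.dotProduct_mulVec_zero_iff _).1 h1) x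
  simpa [dotProduct, mulVec, mul_apply] using h2

/-- Two positive semidefinite matrices are simultaneously diagonalizable by congruence. -/
theorem PosSemidef.exists_simultaneous_diagonal [DecidableEq ι] {P Q : Matrix ι ι ℂ}
    (hP : P.PosSemidef) (hQ : Q.PosSemidef) :
    ∃ (s : Finset ι) (L : Matrix ι s ℂ) (M : Matrix s ι ℂ) (p q : s → ℂ),
      M * L = 1 ∧ P = L * diagonal p * Lᴴ ∧ Q = L * diagonal q * Lᴴ := by
  obtain ⟨s, L, M, hML, hS⟩ := (hP.add hQ).exists_leftInverse_factor
  have hLM : Lᴴ * Mᴴ = 1 := by rw [← conjTranspose_mul, hML, conjTranspose_one]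
  -- `Lᴴ * K = 0`, so `P + Q` kills `K`; by positivity so does `P`. Thus `P` is determined by its
  -- compression `M * P * Mᴴ`.
  let K : Matrix ι ι ℂ := 1 - Mᴴ * Lᴴ
  have hSK : (P + Q) * K = 0 := by
    rw [hS, Matrix.mul_assoc, Matrix.mul_sub, ← Matrix.mul_assoc, hLM, Matrix.one_mul,
      Matrix.mul_one, sub_self, Matrix.mul_zero]
  have hPK : P * K = 0 := by
    apply hP.mul_eq_zero_of_conjTranspose_mul_mul
    have h1 := hP.conjTranspose_mul_mul_same K
    have h2 := hQ.conjTranspose_mul_mul_same K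
    have h3 : Kᴴ * P * K + Kᴴ * Q * K = 0 := by
      rw [← Matrix.add_mul, ← Matrix.mul_add, Matrix.mul_assoc, hSK, Matrix.mul_zero]
    open scoped MatrixOrder in
    exact le_antisymm (by rw [eq_neg_of_add_eq_zero_left h3]; exact neg_nonpos.2 h2.nonneg)
      h1.nonneg
  have hPr : P = P * (Mᴴ * Lᴴ) := by
    rwa [Matrix.mul_sub, Matrix.mul_one, sub_eq_zero] at hPK
  have hPl : P = L * M * P := by
    have := congr_arg Matrix.conjTranspose hPr
    simpa [conjTranspose_mul, hP.1.eq, Matrix.mul_assoc] using this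
  have hN : (M * P * Mᴴ).IsHermitian := (hP.mul_mul_conjTranspose_same M).1
  let V : Matrix s s ℂ := hN.eigenvectorUnitary
  have hV : Vᴴ * V = 1 := Unitary.coe_star_mul_self hN.eigenvectorUnitary
  have hV' : V * Vᴴ = 1 := Unitary.coe_mul_star_self hN.eigenvectorUnitary
  let p : s → ℂ := fun a => (hN.eigenvalues a : ℂ)
  have hNd : M * P * Mᴴ = V * diagonal p * Vᴴ := by
    have := hN.spectral_theorem
    rwa [Unitary.conjStarAlgAut_apply] at this
  have hPd : P = L * V * diagonal p * (L * V)ᴴ := by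
    calc P = L * (M * P * Mᴴ) * Lᴴ := by
          conv_lhs => rw [hPr, hPl]
          simp only [Matrix.mul_assoc]
      _ = _ := by rw [hNd, conjTranspose_mul]; simp only [Matrix.mul_assoc]
  -- In these coordinates `P + Q` is the identity, so `Q` is diagonal with entries `1 - p a`.
  refine ⟨s, L * V, Vᴴ * M, p, fun a => 1 - p a, ?_, hPd, ?_⟩
  · rw [Matrix.mul_assoc, ← Matrix.mul_assoc M, hML, Matrix.one_mul, hV]
  · have hSd : P + Q = L * V * diagonal (1 : s → ℂ) * (L * V)ᴴ := by
      rw [hS, show diagonal (1 : s → ℂ) = 1 from diagonal_one, Matrix.mul_one,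
        conjTranspose_mul, Matrix.mul_assoc, ← Matrix.mul_assoc V, hV', Matrix.one_mul]
    have h1 : (diagonal (fun a => 1 - p a) : Matrix s s ℂ) = diagonal (1 : s → ℂ) - diagonal p :=
      (diagonal_sub _ _).symm
    rw [h1, Matrix.mul_sub, Matrix.sub_mul, ← hSd, ← hPd, add_sub_cancel_left]

/-- A space of matrices of dimension at most two that is spanned by positive semidefinite matrices
is fixed by a map `X ↦ ∑ a, (uₐ* X uₐ) Eₐ` with `Eₐ` positive semidefinite. -/
theorem exists_quadForm_posSemidef_expansion [DecidableEq ι] {T : Set (Matrix ι ι ℂ)}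
    (hT : ∀ X ∈ T, X.PosSemidef) (hr : Module.finrank ℂ (Submodule.span ℂ T) ≤ 2) :
    ∃ (s : Finset ι) (u : s → ι → ℂ) (E : s → Matrix ι ι ℂ), (∀ a, (E a).PosSemidef) ∧
      ∀ X ∈ Submodule.span ℂ T, ∑ a, quadForm (u a) X • E a = X := by
  obtain ⟨P, Q, hP, hQ, hTPQ⟩ : ∃ P Q : Matrix ι ι ℂ, P.PosSemidef ∧ Q.PosSemidef ∧
      Submodule.span ℂ T ≤ Submodule.span ℂ {P, Q} := by
    obtain ⟨f, hf, hspan, -⟩ := Submodule.exists_fun_fin_finrank_span_eq ℂ T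
    -- Padding by `0` covers dimensions below 2.
    let g : ℕ → Matrix ι ι ℂ := fun j => if h : j < Module.finrank ℂ (Submodule.span ℂ T)
      then f ⟨j, h⟩ else 0
    have hg (j) : (g j).PosSemidef := by
      by_cases h : j < Module.finrank ℂ (Submodule.span ℂ T)
      · simp only [g, h, dif_pos]; exact hT _ (hf _)
      · simp only [g, h, dif_neg, not_false_eq_true]; exact PosSemidef.zero
    refine ⟨g 0, g 1, hg 0, hg 1, ?_⟩
    rw [← hspan]
    apply Submodule.span_mono
    rintro _ ⟨j, rfl⟩
    have hj : f j = g j := by simp [g]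
    have : (j : ℕ) = 0 ∨ (j : ℕ) = 1 := by have := j.2; omega
    rcases this with h | h <;> simp [hj, h]
  obtain ⟨s, L, M, p, q, hML, rfl, rfl⟩ := hP.exists_simultaneous_diagonal hQ
  -- The form at `star (M a)` reads off the `a`-th diagonal coefficient, because `M * L = 1`.
  refine ⟨s, fun a => star (M a), fun a => L * diagonal (Pi.single a (1 : ℂ)) * Lᴴ,
    fun a => (PosSemidef.diagonal (Pi.single_nonneg.2 zero_le_one)).mul_mul_conjTranspose_same L, ?_⟩
  have hLM : Lᴴ * Mᴴ = 1 := by rw [← conjTranspose_mul, hML, conjTranspose_one]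
  have key (d : s → ℂ) : ∑ a, quadForm (star (M a)) (L * diagonal d * Lᴴ) •
      (L * diagonal (Pi.single a (1 : ℂ)) * Lᴴ) = L * diagonal d * Lᴴ := by
    have h (a : s) : quadForm (star (M a)) (L * diagonal d * Lᴴ) = d a := by
      have h1 : quadForm (star (M a)) (L * diagonal d * Lᴴ)
          = (M * (L * diagonal d * Lᴴ) * Mᴴ) a a := by
        rw [quadForm_apply, Matrix.mul_assoc M, mul_apply, star_star]
        rfl
      have h2 : M * (L * diagonal d * Lᴴ) * Mᴴ = (M * L) * diagonal d * (Lᴴ * Mᴴ) := by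
        simp only [Matrix.mul_assoc]
      rw [h1, h2, hML, hLM, Matrix.one_mul, Matrix.mul_one, diagonal_apply_eq]
    have hd : diagonal d = ∑ a, d a • diagonal (Pi.single a (1 : ℂ)) := by
      ext x y
      simp only [Matrix.sum_apply, Matrix.smul_apply, diagonal_apply, smul_eq_mul]
      by_cases hxy : x = y <;> simp [hxy, Pi.single_apply]
    simp only [h]
    conv_rhs => rw [hd, Matrix.mul_sum, Matrix.sum_mul]
    simp only [Matrix.mul_smul, Matrix.smul_mul]
  intro X hX
  obtain ⟨b, c, rfl⟩ := Submodule.mem_span_pair.1 (hTPQ hX)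
  simp only [map_add, map_smul, add_smul, Finset.sum_add_distrib, smul_assoc, ← Finset.smul_sum,
    key]

end Matrix

/-- A multilinear map vanishing on a product of sets vanishes on the product of their spans. -/
theorem MultilinearMap.eq_zero_of_mem_span {R ι N : Type*} [CommSemiring R] [Fintype ι]
    {M : ι → Type*} [∀ i, AddCommMonoid (M i)] [∀ i, Module R (M i)] [AddCommMonoid N] [Module R N]
    (f : MultilinearMap R M N) (s : ∀ i, Set (M i)) (h : ∀ m, (∀ i, m i ∈ s i) → f m = 0)
    (m : ∀ i, M i) (hm : ∀ i, m i ∈ Submodule.span R (s i)) : f m = 0 := by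
  classical
  suffices H : ∀ (t : Finset ι) (m : ∀ i, M i), (∀ i ∈ t, m i ∈ Submodule.span R (s i)) →
      (∀ i ∉ t, m i ∈ s i) → f m = 0 from
    H Finset.univ m (fun i _ => hm i) fun i hi => absurd (Finset.mem_univ i) hi
  intro t
  induction t using Finset.induction_on with
  | empty => exact fun m _ h2 => h m fun i => h2 i (Finset.notMem_empty i)
  | insert a t ha ih =>
    intro m h1 h2
    have key : ∀ x ∈ Submodule.span R (s a), f (Function.update m a x) = 0 := by
      intro x hx
      induction hx using Submodule.span_induction with
      | mem x hx =>
        refine ih _ (fun i hi => ?_) (fun i hi => ?_)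
        · rw [Function.update_of_ne (ne_of_mem_of_not_mem hi ha)]
          exact h1 i (Finset.mem_insert_of_mem hi)
        · by_cases hia : i = a
          · subst hia; rwa [Function.update_self]
          · rw [Function.update_of_ne hia]
            exact h2 i (by simp [hia, hi])
      | zero => exact f.map_update_zero m a
      | add x y _ _ hx hy => rw [f.map_update_add, hx, hy, add_zero]
      | smul c x _ hx => rw [f.map_update_smul, hx, smul_zero]
    simpa using key (m a) (h1 a (Finset.mem_insert_self a t))

/-! ### Product forms on tensors. -/

namespace MatrixTensor

open PiTensorProduct Matrix

variable {n : ℕ} {k : Fin n → ℕ}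

/-- The functional `X₁ ⊗ ⋯ ⊗ Xₙ ↦ ∏ i, wᵢ* Xᵢ wᵢ`. -/
noncomputable def productForm (w : ∀ i, Fin (k i) → ℂ) : Module.Dual ℂ (MatrixTensor k) :=
  dualDistrib (tprod ℂ fun i => quadForm (w i))

theorem productForm_tprod (w : ∀ i, Fin (k i) → ℂ) (X : ∀ i, Matrix (Fin (k i)) (Fin (k i)) ℂ) :
    productForm w (tprod ℂ X) = ∏ i, quadForm (w i) (X i) :=
  dualDistrib_apply _ _

/-- The functional `productForm w` is the value of the quadratic form at the product vector of
`w`. -/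
theorem productForm_eq_quadForm (w : ∀ i, Fin (k i) → ℂ) (A : MatrixTensor k) :
    productForm w A = quadForm (fun x => ∏ i, w i (x i)) (toMatrix k A) := by
  suffices productForm w = quadForm (fun x => ∏ i, w i (x i)) ∘ₗ toMatrix k by rw [this]; rfl
  refine PiTensorProduct.ext (MultilinearMap.ext fun X => ?_)
  simp only [LinearMap.compMultilinearMap_apply, LinearMap.comp_apply, productForm_tprod, toMatrix,
    lift.tprod, quadForm_apply, dotProduct, mulVec, multiKronecker, MultilinearMap.coe_mk,
    Matrix.of_apply, Pi.star_apply, Complex.star_def, map_prod]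
  rw [Finset.prod_univ_sum, Fintype.piFinset_univ]
  refine Finset.sum_congr rfl fun x _ => ?_
  rw [Finset.prod_mul_distrib, Finset.prod_univ_sum, Fintype.piFinset_univ]
  simp only [Finset.prod_mul_distrib]

theorem IsPosSemidef.productForm_nonneg {A : MatrixTensor k} (hA : A.IsPosSemidef)
    (w : ∀ i, Fin (k i) → ℂ) : 0 ≤ productForm w A := by
  rw [productForm_eq_quadForm]
  exact hA.dotProduct_mulVec_nonneg _

/-- The functionals `productForm w` separate tensors. -/
theorem eq_zero_of_productForm {A : MatrixTensor k} (h : ∀ w, productForm w A = 0) : A = 0 := by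
  apply (toMatrix_bijective k).1
  rw [map_zero]
  ext x y
  -- Evaluation at `A`, as a multilinear map in the functionals: polarization in each slot passes
  -- from quadratic forms to matrix entries.
  let F := (LinearMap.applyₗ A ∘ₗ dualDistrib).compMultilinearMap
    (tprod ℂ (s := fun i => Module.Dual ℂ (Matrix (Fin (k i)) (Fin (k i)) ℂ)))
  have hF : F (fun i => entryLinearMap ℂ ℂ (x i) (y i)) = 0 := by
    refine F.eq_zero_of_mem_span (fun i => Set.range quadForm) (fun m hm => ?_) _
      fun i => entryLinearMap_mem_span_quadForm _ _
    choose w hw using hm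
    obtain rfl : (fun i => quadForm (w i)) = m := funext hw
    exact h w
  suffices entryLinearMap ℂ ℂ x y ∘ₗ toMatrix k
      = dualDistrib (tprod ℂ fun i => entryLinearMap ℂ ℂ (x i) (y i)) from
    (LinearMap.congr_fun this A).trans hF
  refine PiTensorProduct.ext (MultilinearMap.ext fun X => ?_)
  simp [toMatrix, multiKronecker]

theorem eq_of_productForm {A B : MatrixTensor k} (h : ∀ w, productForm w A = productForm w B) :
    A = B :=
  sub_eq_zero.1 (eq_zero_of_productForm fun w => by rw [map_sub, h, sub_self])

/-! ### Contractions to one factor. -/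

/-- The contraction of `∑ j, v j 0 ⊗ ⋯ ⊗ v j (n - 1)` with the quadratic forms at `w l`, in all
factors `l` except the factor `i`. -/
noncomputable def contraction {r : ℕ} (v : Fin r → ∀ i, Matrix (Fin (k i)) (Fin (k i)) ℂ)
    (i : Fin n) (w : ∀ i, Fin (k i) → ℂ) : Matrix (Fin (k i)) (Fin (k i)) ℂ :=
  ∑ j, (∏ l ∈ Finset.univ.erase i, quadForm (w l) (v j l)) • v j i

variable {r : ℕ} (v : Fin r → ∀ i, Matrix (Fin (k i)) (Fin (k i)) ℂ)

theorem apply_contraction (i : Fin n) (w : ∀ i, Fin (k i) → ℂ)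
    (f : Module.Dual ℂ (Matrix (Fin (k i)) (Fin (k i)) ℂ)) :
    f (contraction v i w)
      = ∑ j, (∏ l ∈ Finset.univ.erase i, quadForm (w l) (v j l)) * f (v j i) := by
  simp [contraction]

theorem quadForm_contraction (i : Fin n) (w : ∀ i, Fin (k i) → ℂ) (u : Fin (k i) → ℂ) :
    quadForm u (contraction v i w) = productForm (Function.update w i u) (∑ j, tprod ℂ (v j)) := by
  rw [apply_contraction, map_sum]
  refine Finset.sum_congr rfl fun j _ => ?_
  rw [productForm_tprod, ← Finset.mul_prod_erase _ _ (Finset.mem_univ i), Function.update_self,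
    mul_comm]
  congr 1
  refine Finset.prod_congr rfl fun l hl => ?_
  rw [Function.update_of_ne (Finset.ne_of_mem_erase hl)]

theorem contraction_posSemidef (hA : IsPosSemidef (∑ j, tprod ℂ (v j))) (i : Fin n)
    (w : ∀ i, Fin (k i) → ℂ) : (contraction v i w).PosSemidef :=
  posSemidef_of_quadForm_nonneg fun u => by
    rw [quadForm_contraction]
    exact hA.productForm_nonneg _

theorem finrank_span_contraction_le (i : Fin n) :
    Module.finrank ℂ (Submodule.span ℂ (Set.range (contraction v i))) ≤ r := by
  have h : Submodule.span ℂ (Set.range (contraction v i))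
      ≤ Submodule.span ℂ (Set.range fun j => v j i) := by
    rw [Submodule.span_le]
    rintro _ ⟨w, rfl⟩
    exact sum_mem fun j _ => Submodule.smul_mem _ _ (Submodule.subset_span ⟨j, rfl⟩)
  refine (Submodule.finrank_mono h).trans ?_
  exact (finrank_range_le_card fun j => v j i).trans_eq (Fintype.card_fin r)

/-- A linear map in one factor that fixes all contractions to this factor fixes the tensor. -/
theorem map_update_eq_self {i : Fin n}
    {p : Matrix (Fin (k i)) (Fin (k i)) ℂ →ₗ[ℂ] Matrix (Fin (k i)) (Fin (k i)) ℂ}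
    (hp : ∀ w, p (contraction v i w) = contraction v i w) :
    PiTensorProduct.map (Function.update (fun _ => LinearMap.id) i p) (∑ j, tprod ℂ (v j))
      = ∑ j, tprod ℂ (v j) := by
  refine eq_of_productForm fun w => ?_
  have h1 := quadForm_contraction v i w (w i)
  rw [Function.update_eq_self] at h1
  rw [← h1, ← hp w]
  have h2 := apply_contraction v i w (quadForm (w i) ∘ₗ p)
  rw [LinearMap.comp_apply] at h2
  rw [h2, map_sum, map_sum]
  refine Finset.sum_congr rfl fun j _ => ?_
  rw [map_tprod, productForm_tprod, ← Finset.mul_prod_erase _ _ (Finset.mem_univ i),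
    Function.update_self, mul_comm]
  congr 1
  refine Finset.prod_congr rfl fun l hl => ?_
  rw [Function.update_of_ne (Finset.ne_of_mem_erase hl), LinearMap.id_apply]

/-- One factor at a time: each single-factor map fixes the whole tensor, hence so does their
composite. -/
theorem map_eq_self
    {p : ∀ i, Matrix (Fin (k i)) (Fin (k i)) ℂ →ₗ[ℂ] Matrix (Fin (k i)) (Fin (k i)) ℂ}
    (hp : ∀ i w, p i (contraction v i w) = contraction v i w) :
    PiTensorProduct.map p (∑ j, tprod ℂ (v j)) = ∑ j, tprod ℂ (v j) := by
  classical
  suffices H : ∀ t : Finset (Fin n), PiTensorProduct.map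
      (fun i => if i ∈ t then p i else LinearMap.id) (∑ j, tprod ℂ (v j)) = ∑ j, tprod ℂ (v j) by
    simpa using H Finset.univ
  intro t
  induction t using Finset.induction_on with
  | empty => simp [PiTensorProduct.map_id]
  | insert a t ha ih =>
    have : (fun i => if i ∈ insert a t then p i else LinearMap.id)
        = fun i => (Function.update (fun _ => LinearMap.id) a (p a) : ∀ i,
          Matrix (Fin (k i)) (Fin (k i)) ℂ →ₗ[ℂ] Matrix (Fin (k i)) (Fin (k i)) ℂ) i ∘ₗ
            (if i ∈ t then p i else LinearMap.id) := by
      funext i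
      by_cases hi : i = a
      · subst hi; simp [ha, LinearMap.comp_id]
      · simp [hi, LinearMap.id_comp]
    rw [this, PiTensorProduct.map_comp, LinearMap.comp_apply, ih, map_update_eq_self v (hp a)]

/-! ### Separability. -/

theorem isSeparable_of_fintype {σ : Type*} [Fintype σ] {A : MatrixTensor k}
    (C : σ → ∀ i, Matrix (Fin (k i)) (Fin (k i)) ℂ) (hC : ∀ a i, (C a i).PosSemidef)
    (hA : A = ∑ a, tprod ℂ (C a)) : A.IsSeparable :=
  ⟨Fintype.card σ, fun j => C ((Fintype.equivFin σ).symm j), fun _ _ => hC _ _,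
    hA.trans ((Fintype.equivFin σ).symm.sum_comp fun a => tprod ℂ (C a)).symm⟩

/-- A sum of at most two elementary tensors that is positive semidefinite is separable. -/
theorem isSeparable_sum_tprod (hr : r ≤ 2) (hA : IsPosSemidef (∑ j, tprod ℂ (v j))) :
    IsSeparable (∑ j, tprod ℂ (v j)) := by
  classical
  rcases Nat.eq_zero_or_pos n with rfl | hn
  · exact ⟨r, v, fun _ i => i.elim0, rfl⟩
  let i₀ : Fin n := ⟨0, hn⟩
  have H (i : Fin n) := exists_quadForm_posSemidef_expansion
    (T := Set.range (contraction v i)) (by rintro _ ⟨w, rfl⟩; exact contraction_posSemidef v hA i w)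
    ((finrank_span_contraction_le v i).trans hr)
  choose s u E hE hfix using H
  let p (i) : Matrix (Fin (k i)) (Fin (k i)) ℂ →ₗ[ℂ] Matrix (Fin (k i)) (Fin (k i)) ℂ :=
    ∑ a, (quadForm (u i a)).smulRight (E i a)
  have hp (i X) : p i X = ∑ a, quadForm (u i a) X • E i a := by simp [p]
  have hmap := map_eq_self v (p := p) fun i w => by
    rw [hp]; exact hfix i _ (Submodule.subset_span ⟨w, rfl⟩)
  let c (b : ∀ i, s i) : ℂ := productForm (fun i => u i (b i)) (∑ j, tprod ℂ (v j))
  have hexp : ∑ j, tprod ℂ (v j) = ∑ b : ∀ i, s i, c b • tprod ℂ fun i => E i (b i) := by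
    conv_lhs => rw [← hmap]
    simp only [map_sum, map_tprod, hp, MultilinearMap.map_sum, MultilinearMap.map_smul_univ, c,
      productForm_tprod, Finset.sum_smul]
    exact Finset.sum_comm
  refine isSeparable_of_fintype (fun b : ∀ i, s i =>
    Function.update (fun i => E i (b i)) i₀ (c b • E i₀ (b i₀))) (fun b i => ?_) ?_
  · by_cases hi : i = i₀
    · subst hi
      rw [Function.update_self]
      exact (hE _ _).smul (hA.productForm_nonneg _)
    · rw [Function.update_of_ne hi]
      exact hE _ _
  · rw [hexp]
    refine Finset.sum_congr rfl fun b _ => ?_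
    rw [MultilinearMap.map_update_smul, Function.update_eq_self i₀ fun i => E i (b i)]

end MatrixTensor

theorem exists_eq_sum_tprod_of_tensorRank_le {K : Type*} [Field K] {n : ℕ} {V : Fin n → Type*}
    [∀ i, AddCommGroup (V i)] [∀ i, Module K (V i)] {t : ⨂[K] i, V i} {m : ℕ}
    (h : tensorRank t ≤ m) :
    ∃ r ≤ m, ∃ v : Fin r → ∀ i, V i, t = ∑ j, PiTensorProduct.tprod K (v j) := by
  unfold tensorRank at h
  rcases Set.eq_empty_or_nonempty {m : ℕ∞ | ∃ (r : ℕ) (v : Fin r → ∀ i, V i), m = r ∧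
    (∀ j, PiTensorProduct.tprod K (v j) ≠ 0) ∧ t = ∑ j, PiTensorProduct.tprod K (v j)} with he | he
  · rw [he, sInf_empty] at h
    -- The infimum of the empty set is `⊤`, which exceeds `m`.
    exact absurd h (by simp)
  · obtain ⟨r, v, hr, -, hv⟩ := csInf_mem he
    rw [hr] at h
    exact ⟨r, by exact_mod_cast h, v, hv⟩

theorem mainTheorem12 (n : ℕ) (k : Fin n → ℕ) (A : MatrixTensor k)
    (hA : A.IsPosSemidef) (hrank : tensorRank A ≤ 2) : A.IsSeparable := by
  obtain ⟨r, hr, v, rfl⟩ := exists_eq_sum_tprod_of_tensorRank_le (m := 2) hrank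
  exact MatrixTensor.isSeparable_sum_tprod v hr hA
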